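/- Let $I$ be a finite set and $(n_i)_{i\in I}$ a family with $n_i\in\{1,2\}$. A \emph{finite binary structure} of signature $(n_i)_{i\in I}$ is a pair $R=(V,(\rho_i)_{i\in I})$ with $V$ a finite set and $\rho_i$ an $n_i$-ary relation on $V$. A class $\mathcal C$ of such structures is \emph{hereditary} if it contains every structure that is isomorphic to an induced substructure of a member of $\mathcal C$. A \emph{module} of $R$ is a subset $A\subseteq V$ such that $(x\,\rho_i\,a\Leftrightarrow x\,\rho_i\,a')$ and $(a\,\rho_i\,x\Leftrightarrow a'\,\rho_i\,x)$ for all $a,a'\in A$, all $x\in V\setminus A$ and all $i\in I$ with $n_i=2$ (unary relations impose no condition). The structure $R$ is \emph{prime} if its only modules are $\emptyset$, the singletons and $V$. A hereditary class is \emph{minimal prime} if it contains infinitely many prime structures up to isomorphism, while every proper hereditary subclass of it contains only finitely many prime structures up to isomorphism. **Theorem.** Every hereditary class of finite binary structures of a given finite signature that contains infinitely many prime structures, up to isomorphism, contains a hereditary subclass that is minimal prime. -/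

import Mathlib

universe u v w

namespace BinaryStructures

open FirstOrder

/-- `L` is the signature of binary structures: there are no function symbols, every relation symbol
has arity one or two, and there are finitely many symbols. -/
structure IsFiniteBinarySignature (L : FirstOrder.Language.{u, v}) : Prop where
  isRelational : L.IsRelational
  arity : ∀ n : ℕ, Nonempty (L.Relations n) → n = 1 ∨ n = 2
  finite : Finite (Σ n : ℕ, L.Relations n)

variable (L : FirstOrder.Language.{u, v})

/-- `A` is a module of the binary structure `M`. A unary relation `U`, read as the binary relation
`{(y, y) | y ∈ U}`, holds between no element of `A` and no element outside `A`; hence it imposes no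
condition, and only the binary relations occur below. -/
def IsModule (M : Type w) [L.Structure M] (A : Set M) : Prop :=
  ∀ ρ : L.Relations 2, ∀ a ∈ A, ∀ a' ∈ A, ∀ x ∉ A,
    (Language.Structure.RelMap ρ ![x, a] ↔ Language.Structure.RelMap ρ ![x, a']) ∧
    (Language.Structure.RelMap ρ ![a, x] ↔ Language.Structure.RelMap ρ ![a', x])

/-- A structure is prime if its only modules are the trivial ones: the empty set, the singletons
and the whole domain. -/
def IsPrimeStructure (M : Type w) [L.Structure M] : Prop :=
  ∀ A : Set M, IsModule L M A → A = ∅ ∨ (∃ a, A = {a}) ∨ A = Set.univ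

variable {L}

/-- A hereditary class of finite structures: every structure that embeds into a member of the class
is a member of the class. In a relational language, `Language.Hereditary` (closure under
finitely generated substructures) says exactly this when the members are finite. -/
def IsHereditaryClass (C : Set (CategoryTheory.Bundled.{w} L.Structure)) : Prop :=
  (∀ M ∈ C, Finite M) ∧ Language.Hereditary C

/-- The prime members of `C`, up to isomorphism. -/
def primes (C : Set (CategoryTheory.Bundled.{w} L.Structure)) :
    Set (Quotient (Language.equivSetoid (L := L))) :=
  Quotient.mk _ '' {M | M ∈ C ∧ IsPrimeStructure L M}

/-- A minimal prime class: a hereditary class of finite structures that contains infinitely many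
primes, every proper hereditary subclass of which contains only finitely many primes. -/
def IsMinimalPrime (C : Set (CategoryTheory.Bundled.{w} L.Structure)) : Prop :=
  IsHereditaryClass C ∧ (primes C).Infinite ∧
    ∀ D : Set (CategoryTheory.Bundled.{w} L.Structure),
      IsHereditaryClass D → D ⊂ C → (primes D).Finite

end BinaryStructures

namespace BinaryStructures

/-! ### Modules and prime sets of a coloring of ordered pairs. -/

section Coloring

variable {V K : Type*}

/-! Zorn's lemma, applied downwards to hereditary classes with infinitely many primes, gives a
minimal one once `infinite_primes_sInter` shows that intersections of nonempty chains keep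
infinitely many primes. The danger is that the surviving primes run off to infinite size.
`IsPrimeOn.exists_ncard` prevents this: a class with infinitely many primes has, for each `n ≥ 3`, a
prime of size `n` or `n + 1`. Up to isomorphism there are finitely many of these, so by pigeonhole
one lies in every member of the chain. That size statement is an induction. It starts from a prime
set of size 3 or 4 (`IsPrimeOn.exists_small`) and adds one or two elements at a time
(`exists_isPrimeOn_insert`). Modules depend only on the coloring of each ordered pair by the
relations holding in both directions, so the combinatorics is done for reversible colorings. -/

/-- `A` is a module of the restriction to `X` of the coloring `c` of the ordered pairs. -/
def IsModuleOn (c : V → V → K) (X A : Set V) : Prop :=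
  A ⊆ X ∧ ∀ a ∈ A, ∀ a' ∈ A, ∀ x ∈ X, x ∉ A → c x a = c x a'

/-- The restriction of the coloring `c` to `X` has only trivial modules. -/
def IsPrimeOn (c : V → V → K) (X : Set V) : Prop :=
  ∀ A, IsModuleOn c X A → A.Subsingleton ∨ A = X

/-- The color of a pair determines the color of the reversed pair. -/
def IsReversible (c : V → V → K) : Prop :=
  ∀ a b x y, c a b = c x y → c b a = c y x

/-- Outside `u`, no element of `X` distinguishes `x` from `u`. -/
def IsTwin (c : V → V → K) (X : Set V) (x u : V) : Prop :=
  ∀ z ∈ X, z ≠ u → c z x = c z u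

/-- `x` does not distinguish the elements of `X`. -/
def IsFlat (c : V → V → K) (X : Set V) (x : V) : Prop :=
  ∀ a ∈ X, ∀ b ∈ X, c x a = c x b

variable {c : V → V → K} {X : Set V}

/-! ### Extending a prime set by one or two elements. -/

theorem IsPrimeOn.trace (hX : IsPrimeOn c X) {Z A : Set V} (hXZ : X ⊆ Z)
    (hA : IsModuleOn c Z A) :
    X ⊆ A ∨ (∀ z ∈ X, z ∉ A) ∨ ∃ v ∈ X, v ∈ A ∧ ∀ z ∈ X, z ∈ A → z = v := by
  have h : IsModuleOn c X (A ∩ X) := ⟨Set.inter_subset_right, fun a ha a' ha' x hx hxA =>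
    hA.2 a ha.1 a' ha'.1 x (hXZ hx) fun h => hxA ⟨h, hx⟩⟩
  rcases hX _ h with h | h
  · rcases Set.eq_empty_or_nonempty (A ∩ X) with h0 | ⟨v, hv⟩
    · exact Or.inr (Or.inl fun z hz hzA => (h0.subset ⟨hzA, hz⟩).elim)
    · exact Or.inr (Or.inr ⟨v, hv.2, hv.1, fun z hz hzA => h ⟨hzA, hz⟩ hv⟩)
  · exact Or.inl (Set.inter_eq_right.1 h)

theorem IsPrimeOn.exists_distinguishes (hX : IsPrimeOn c X) (h3 : 3 ≤ X.ncard) {u v : V}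
    (hu : u ∈ X) (hv : v ∈ X) (huv : u ≠ v) : ∃ z ∈ X, z ≠ u ∧ z ≠ v ∧ c z u ≠ c z v := by
  by_contra! H
  have hm : IsModuleOn c X {u, v} := by
    refine ⟨by grind, ?_⟩
    intro a ha a' ha' x hx hxA
    grind
  rcases hX _ hm with h | h
  · exact huv (h (by simp) (by simp))
  · rw [← h, Set.ncard_pair huv] at h3
    omega

theorem IsPrimeOn.exists_distinguished (hX : IsPrimeOn c X) (h3 : 3 ≤ X.ncard) {u : V}
    (hu : u ∈ X) : ∃ a ∈ X, ∃ b ∈ X, a ≠ u ∧ b ≠ u ∧ c u a ≠ c u b := by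
  by_contra! H
  have hfin : X.Finite := Set.finite_of_ncard_pos (by omega)
  have hm : IsModuleOn c X (X \ {u}) := by
    refine ⟨Set.sdiff_subset, ?_⟩
    intro a ha a' ha' x hx hxA
    have : x = u := by grind
    subst this
    exact H a ha.1 a' ha'.1 ha.2 ha'.2
  have hc := Set.ncard_sdiff_singleton_of_mem hu
  rcases hX _ hm with h | h
  · have := (Set.ncard_le_one (hfin.sdiff)).2 fun a ha b hb => h ha hb
    omega
  · rw [h] at hc
    omega

theorem IsPrimeOn.not_isTwin_of_isTwin (hX : IsPrimeOn c X) (h3 : 3 ≤ X.ncard) {x u v : V}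
    (hu : u ∈ X) (hv : v ∈ X) (hxu : IsTwin c X x u) (hxv : IsTwin c X x v) : u = v := by
  by_contra huv
  obtain ⟨z, hz, h1, h2, h⟩ := hX.exists_distinguishes h3 hu hv huv
  exact h ((hxu z hz h1).symm.trans (hxv z hz h2))

theorem IsPrimeOn.not_isFlat_of_isTwin (hc : IsReversible c) (hX : IsPrimeOn c X)
    (h3 : 3 ≤ X.ncard) {x u : V} (hu : u ∈ X) (hxu : IsTwin c X x u) : ¬ IsFlat c X x := by
  intro hf
  obtain ⟨a, ha, b, hb, h1, h2, h⟩ := hX.exists_distinguished h3 hu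
  exact h (((hc _ _ _ _ (hxu a ha h1)).symm.trans (hf a ha b hb)).trans
    (hc _ _ _ _ (hxu b hb h2)))

theorem not_isPrimeOn_iff : ¬ IsPrimeOn c X ↔
    ∃ A, IsModuleOn c X A ∧ (∃ a ∈ A, ∃ b ∈ A, a ≠ b) ∧ ∃ z ∈ X, z ∉ A := by
  unfold IsPrimeOn
  push Not
  refine exists_congr fun A => and_congr_right fun hA => and_congr ?_ ?_
  · rw [← Set.not_subsingleton_iff]
    simp [Set.Subsingleton]
  · rw [← Set.not_subset]
    exact not_congr ⟨fun h => h.superset, fun h => hA.1.antisymm h⟩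

/-- A nontrivial module meets `X` in all of `X` (then `x` is flat) or in one point (then `x` is its
twin). An empty trace would leave only `x`. -/
theorem isFlat_or_isTwin_of_not_isPrimeOn (hX : IsPrimeOn c X) {x : V}
    (hn : ¬ IsPrimeOn c (insert x X)) : IsFlat c X x ∨ ∃ u ∈ X, IsTwin c X x u := by
  obtain ⟨A, hA, ⟨a, ha, b, hb, hab⟩, z, hz, hzA⟩ := not_isPrimeOn_iff.1 hn
  have haX := hA.1 ha
  have hbX := hA.1 hb
  rcases hX.trace (Set.subset_insert x X) hA with h | h | ⟨v, hv, hvA, h⟩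
  · left
    have : x ∉ A := by grind
    exact fun p hp q hq => hA.2 p (h hp) q (h hq) x (by simp) this
  · grind
  · right
    refine ⟨v, hv, fun z hz hzv => hA.2 x ?_ v hvA z (by simp [hz]) ?_⟩ <;> grind

/-- This makes `u` together with its twins a module of the whole set when no extension by two
elements is prime. -/
theorem color_eq_of_isTwin (hc : IsReversible c) (hX : IsPrimeOn c X) (h3 : 3 ≤ X.ncard)
    {x y u : V} (hy : y ∉ X) (hu : u ∈ X) (hxu : IsTwin c X x u)
    (hyu : ¬ IsTwin c X y u) (hn : ¬ IsPrimeOn c (insert x (insert y X))) : c y x = c y u := by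
  obtain ⟨A, hA, ⟨a, ha, b, hb, hab⟩, w, hw, hwA⟩ := not_isPrimeOn_iff.1 hn
  have haX := hA.1 ha
  have hbX := hA.1 hb
  have hflat := hX.not_isFlat_of_isTwin hc h3 hu hxu
  have hxy : x ≠ y := by rintro rfl; exact hyu hxu
  rcases hX.trace (Z := insert x (insert y X)) (by grind) hA with h | h | ⟨v, hv, hvA, h⟩
  · have hxA : x ∈ A := by
      by_contra hxA
      exact hflat fun p hp q hq => hA.2 p (h hp) q (h hq) x (by simp) hxA
    exact hA.2 x hxA u (h hu) y (by simp) (by grind)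
  · have hxA : x ∈ A := by grind
    have hyA : y ∈ A := by grind
    exact (hyu fun z hz hzu =>
      (hA.2 y hyA x hxA z (by simp [hz]) (h z hz)).trans (hxu z hz hzu)).elim
  · by_cases hxA : x ∈ A
    · have hxv : IsTwin c X x v := fun z hz hzv => hA.2 x hxA v hvA z (by simp [hz]) (by grind)
      obtain rfl := hX.not_isTwin_of_isTwin h3 hu hv hxu hxv
      have hyA : y ∉ A := fun hyA => hyu fun z hz hzv =>
        hA.2 y hyA u hvA z (by simp [hz]) (by grind)
      exact hA.2 x hxA u hvA y (by simp) hyA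
    -- Here `y` imitates some `v ≠ u`, so the color is carried from `x` to `u` through `v`.
    · have hyA : y ∈ A := by grind
      have huv : v ≠ u := by
        rintro rfl
        exact hyu fun z hz hzv => hA.2 y hyA v hvA z (by simp [hz]) (by grind)
      have h1 : c x y = c x v := hA.2 y hyA v hvA x (by simp) hxA
      have h2 : c x v = c u v := hc _ _ _ _ (hxu v hv huv)
      have h3 : c u v = c u y := hA.2 v hvA y hyA u (by simp [hu]) (by grind)
      exact hc _ _ _ _ (h1.trans (h2.trans h3))

/-- The flat counterpart: it makes the complement of the flat outside elements a module. -/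
theorem color_eq_of_isFlat (hc : IsReversible c) (hX : IsPrimeOn c X) (h3 : 3 ≤ X.ncard)
    {x y : V} (hxf : IsFlat c X x)
    (hyf : ¬ IsFlat c X y) (hn : ¬ IsPrimeOn c (insert x (insert y X))) :
    ∀ p ∈ X, c x y = c x p := by
  intro p hp
  obtain ⟨A, hA, ⟨a, ha, b, hb, hab⟩, w, hw, hwA⟩ := not_isPrimeOn_iff.1 hn
  have haX := hA.1 ha
  have hbX := hA.1 hb
  rcases hX.trace (Z := insert x (insert y X)) (by grind) hA with h | h | ⟨v, hv, hvA, h⟩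
  · have hyA : y ∈ A := by
      by_contra hyA
      exact hyf fun p hp q hq => hA.2 p (h hp) q (h hq) y (by simp) hyA
    exact hA.2 y hyA p (h hp) x (by simp) (by grind)
  · have hxA : x ∈ A := by grind
    have hyA : y ∈ A := by grind
    have key : ∀ z ∈ X, c x z = c y z := fun z hz =>
      hc _ _ _ _ (hA.2 x hxA y hyA z (by simp [hz]) (h z hz))
    exact (hyf fun q hq r hr => by rw [← key q hq, ← key r hr]; exact hxf q hq r hr).elim
  · have hxA : x ∉ A := fun hxA => hX.not_isFlat_of_isTwin hc h3 hv
      (fun z hz hzv => hA.2 x hxA v hvA z (by simp [hz]) (by grind)) hxf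
    have hyA : y ∈ A := by grind
    exact (hA.2 y hyA v hvA x (by simp) hxA).trans (hxf v hv p hp)

/-- A prime proper restriction of a prime coloring extends to a prime restriction by adding at most
two elements (Ehrenfeucht and Rozenberg). -/
theorem exists_isPrimeOn_insert (hc : IsReversible c) (hX : IsPrimeOn c X) (h3 : 3 ≤ X.ncard)
    (hV : IsPrimeOn c Set.univ) (hne : X ≠ Set.univ) :
    ∃ x ∉ X, ∃ y ∉ X, IsPrimeOn c (insert x (insert y X)) := by
  by_contra! H
  obtain ⟨x, hx⟩ := (Set.ne_univ_iff_exists_notMem X).1 hne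
  have hX1 : 1 < X.ncard := by omega
  obtain ⟨p, hp, q, hq, hpq⟩ :=
    (Set.one_lt_ncard (Set.finite_of_ncard_pos (by omega))).1 hX1
  -- Taking `y = x` covers the extension by a single element.
  rcases isFlat_or_isTwin_of_not_isPrimeOn hX (by simpa using H x hx x hx) with hf | ⟨u, hu, ht⟩
  · have hm : IsModuleOn c Set.univ {y | y ∈ X ∨ ¬ IsFlat c X y} := by
      refine ⟨Set.subset_univ _, ?_⟩
      have key : ∀ z ∉ {y | y ∈ X ∨ ¬ IsFlat c X y}, ∀ a ∈ {y | y ∈ X ∨ ¬ IsFlat c X y},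
          c z a = c z p := by
        intro z hz a ha
        simp only [Set.mem_ofPred_eq, not_or, not_not] at hz ha
        by_cases haX : a ∈ X
        · exact hz.2 a haX p hp
        · exact color_eq_of_isFlat hc hX h3 hz.2 (by tauto) (H z hz.1 a haX) p hp
      exact fun a ha b hb z _ hz => (key z hz a ha).trans (key z hz b hb).symm
    rcases hV _ hm with h | h
    · exact hpq (h (Or.inl hp) (Or.inl hq))
    · have : x ∈ {y | y ∈ X ∨ ¬ IsFlat c X y} := h ▸ Set.mem_univ x
      exact this.elim hx (· hf)
  · have hm : IsModuleOn c Set.univ {y | y = u ∨ y ∉ X ∧ IsTwin c X y u} := by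
      refine ⟨Set.subset_univ _, ?_⟩
      have key : ∀ z ∉ {y | y = u ∨ y ∉ X ∧ IsTwin c X y u},
          ∀ a ∈ {y | y = u ∨ y ∉ X ∧ IsTwin c X y u}, c z a = c z u := by
        rintro z hz a (rfl | ⟨haX, hat⟩)
        · rfl
        · simp only [Set.mem_ofPred_eq, not_or, not_and] at hz
          by_cases hzX : z ∈ X
          · exact hat z hzX hz.1
          · exact color_eq_of_isTwin hc hX h3 hzX hu hat (hz.2 hzX) (H a haX z hzX)
      exact fun a ha b hb z _ hz => (key z hz a ha).trans (key z hz b hb).symm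
    rcases hV _ hm with h | h
    · have : x = u := h (Or.inr ⟨hx, ht⟩) (Or.inl rfl)
      exact hx (this ▸ hu)
    · have h1 : p ∈ {y | y = u ∨ y ∉ X ∧ IsTwin c X y u} := h ▸ Set.mem_univ p
      have h2 : q ∈ {y | y = u ∨ y ∉ X ∧ IsTwin c X y u} := h ▸ Set.mem_univ q
      grind

/-! ### Prime sets of three or four elements. -/

theorem isPrimeOn_triple {x y z : V}
    (hx : c x y ≠ c x z) (hy : c y x ≠ c y z) (hz : c z x ≠ c z y) : IsPrimeOn c {x, y, z} := by
  by_contra hn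
  obtain ⟨A, hA, ⟨a, ha, b, hb, hab⟩, w, hw, hwA⟩ := not_isPrimeOn_iff.1 hn
  have h := hA.2 a ha b hb w hw hwA
  have haX := hA.1 ha
  have hbX := hA.1 hb
  simp only [Set.mem_insert_iff, Set.mem_singleton_iff] at hw haX hbX
  grind

/-- The model is the path `z - x - v - w`: the three non-edges share a color that the edges avoid.
-/
theorem isPrimeOn_quadruple (hc : IsReversible c) {x z v w : V} (h1 : c x z = c x v)
    (hxv : c x v ≠ c x w) (hzx : c z x ≠ c z v) (hz : c z v = c z w) (hxw : c x w = c z w)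
    (hvw : c v w ≠ c z w) : IsPrimeOn c {x, z, v, w} := by
  by_contra hn
  obtain ⟨A, hA, ⟨a, ha, b, hb, hab⟩, t, ht, htA⟩ := not_isPrimeOn_iff.1 hn
  have haX := hA.1 ha
  have hbX := hA.1 hb
  have hm := fun s hs hsA => hA.2 a ha b hb s hs hsA
  have r1 : c v z ≠ c v x := fun h => hxv (by rw [← hc _ _ _ _ h, hz, hxw])
  have r2 : c w z ≠ c w v := fun h => hvw (hc _ _ _ _ h).symm
  have hA2 := hA.2
  simp only [Set.mem_insert_iff, Set.mem_singleton_iff] at ht haX hbX hA2 hm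
  by_cases hxA : x ∈ A <;> by_cases hzA : z ∈ A <;> by_cases hvA : v ∈ A <;>
    by_cases hwA : w ∈ A <;> grind

/-- `s` splits into two nonempty parts such that all pairs from the first part to the second one
have the same color. -/
def HasSplit (c : V → V → K) (s : Set V) : Prop :=
  ∃ P Q : Set V, ∃ k : K, P.Nonempty ∧ Q.Nonempty ∧ Disjoint P Q ∧ P ∪ Q = s ∧
    ∀ p ∈ P, ∀ q ∈ Q, c p q = k

theorem IsReversible.swap (hc : IsReversible c) : IsReversible fun a b => c b a :=
  fun a b x y h => hc b a y x h

theorem IsPrimeOn.swap (hc : IsReversible c) (hX : IsPrimeOn c X) :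
    IsPrimeOn (fun a b => c b a) X :=
  fun A hA => hX A ⟨hA.1, fun a ha b hb x hx hxA => hc _ _ _ _ (hA.2 a ha b hb x hx hxA)⟩

theorem HasSplit.of_swap {s : Set V} (h : HasSplit (fun a b => c b a) s) : HasSplit c s := by
  obtain ⟨P, Q, k, hP, hQ, hd, rfl, h⟩ := h
  exact ⟨Q, P, k, hQ, hP, hd.symm, Set.union_comm _ _, fun q hq p hp => h p hp q hq⟩

theorem hasSplit_singleton_union {s : Set V} {x : V} {k : K} (hs : s.Nonempty) (hx : x ∉ s)
    (h : ∀ y ∈ s, c x y = k) : HasSplit c (insert x s) :=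
  ⟨{x}, s, k, Set.singleton_nonempty x, hs, Set.disjoint_singleton_left.2 hx, rfl, by simpa using h⟩

theorem color_eq_of_no_prime_triple (hc : IsReversible c) {P Q : Set V} {x : V} {k : K}
    (hd : Disjoint P Q) (hk : ∀ p ∈ P, ∀ q ∈ Q, c p q = k)
    (hprime : ∀ Y ⊆ insert x (P ∪ Q), 3 ≤ Y.ncard → Y.ncard ≤ 4 → ¬ IsPrimeOn c Y)
    {p q : V} (hp : p ∈ P) (hq : q ∈ Q) (hpx : c p x ≠ k) (hxq : c x q ≠ k) : c x p = c x q := by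
  by_contra h
  have hpq : p ≠ q := fun h => Set.disjoint_left.1 hd hp (h ▸ hq)
  have hcard : ({x, p, q} : Set V).ncard = 3 :=
    Set.ncard_eq_three.2 ⟨x, p, q, by grind, by grind, hpq, rfl⟩
  refine hprime {x, p, q} (by grind) (by omega) (by omega) (isPrimeOn_triple h ?_ ?_)
  · rwa [hk p hp q hq]
  · exact fun h => hxq ((hc _ _ _ _ h).trans (hk p hp q hq))

/-- Move to the side of `P` both `x` and every element of `Q` that `x` does not see in color `k`. An
obstruction to this new split yields a prime path on four elements. -/
theorem hasSplit_insert_of_mem_right (hc : IsReversible c) {P Q : Set V} {x : V} {k : K}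
    (hd : Disjoint P Q) (hk : ∀ p ∈ P, ∀ q ∈ Q, c p q = k) (hx : x ∉ P ∪ Q)
    (hprime : ∀ Y ⊆ insert x (P ∪ Q), 3 ≤ Y.ncard → Y.ncard ≤ 4 → ¬ IsPrimeOn c Y)
    {z q w : V} (hz : z ∈ P) (hq : q ∈ Q) (hzx : c z x ≠ k) (hxq : c x q ≠ k)
    (hw : w ∈ Q) (hxw : c x w = k) : HasSplit c (insert x (P ∪ Q)) := by
  by_cases H : ∀ v ∈ Q, ∀ w ∈ Q, c x v ≠ k → c x w = k → c v w = k
  · refine ⟨insert x (P ∪ {v ∈ Q | c x v ≠ k}), {w ∈ Q | c x w = k}, k, by simp,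
      ⟨w, hw, hxw⟩, ?_, ?_, ?_⟩
    · rw [Set.disjoint_left] at hd ⊢
      grind
    · ext y
      simp only [Set.mem_union, Set.mem_insert_iff, Set.mem_ofPred_eq]
      tauto
    · rintro p (rfl | hp | hp) q hq
      · exact hq.2
      · exact hk p hp q hq.1
      · exact H p hp.1 q hq.1 hp.2 hq.2
  · push Not at H
    obtain ⟨v, hv, w, hw, hxv, hxw, hvw⟩ := H
    have h1 := color_eq_of_no_prime_triple hc hd hk hprime hz hv hzx hxv
    rw [Set.disjoint_left] at hd
    have hcard : ({x, z, v, w} : Set V).ncard = 4 := by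
      rw [Set.ncard_insert_of_notMem (by grind),
        Set.ncard_eq_three.2 ⟨z, v, w, by grind, by grind, by grind, rfl⟩]
    refine (hprime {x, z, v, w} (by grind) (by omega) (by omega) ?_).elim
    exact isPrimeOn_quadruple hc h1 (by rwa [hxw]) (by rwa [hk z hz v hv])
      (by rw [hk z hz v hv, hk z hz w hw]) (by rw [hxw, hk z hz w hw]) (by rwa [hk z hz w hw])

/-- Either `x` joins a side, or the old split can be shifted, or color `k` never occurs from `P` to
`x` or from `x` to `Q`. In the last case prime triples are avoided only if `x` sees a single color,
and `{x}` splits off. -/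
theorem hasSplit_insert (hc : IsReversible c) {s : Set V} {x : V} (hx : x ∉ s)
    (hprime : ∀ Y ⊆ insert x s, 3 ≤ Y.ncard → Y.ncard ≤ 4 → ¬ IsPrimeOn c Y) (hs : HasSplit c s) :
    HasSplit c (insert x s) := by
  obtain ⟨P, Q, k, hP, hQ, hd, rfl, hk⟩ := hs
  by_cases h1 : ∀ p ∈ P, c p x = k
  · refine ⟨P, insert x Q, k, hP, by simp, ?_, by grind, by grind⟩
    exact Set.disjoint_insert_right.2 ⟨fun h => hx (Or.inl h), hd⟩
  by_cases h2 : ∀ q ∈ Q, c x q = k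
  · refine ⟨insert x P, Q, k, by simp, hQ, ?_, by grind, by grind⟩
    exact Set.disjoint_insert_left.2 ⟨fun h => hx (Or.inr h), hd⟩
  push Not at h1 h2
  obtain ⟨p, hp, hpx⟩ := h1
  obtain ⟨q, hq, hxq⟩ := h2
  by_cases h3 : ∃ w ∈ Q, c x w = k
  · obtain ⟨w, hw, hxw⟩ := h3
    exact hasSplit_insert_of_mem_right hc hd hk hx hprime hp hq hpx hxq hw hxw
  by_cases h4 : ∃ w ∈ P, c w x = k
  · obtain ⟨w, hw, hwx⟩ := h4
    -- Reversing all pairs exchanges the roles of `P` and `Q`.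
    rw [Set.union_comm] at hx hprime ⊢
    exact (hasSplit_insert_of_mem_right hc.swap hd.symm (fun a ha b hb => hk b hb a ha) hx
      (fun Y hY h3 h4 hYp => hprime Y hY h3 h4 (hYp.swap hc.swap)) hq hp hxq hpx hw hwx).of_swap
  push Not at h3 h4
  have key := fun p hp q hq => color_eq_of_no_prime_triple hc hd hk hprime (p := p) (q := q)
    hp hq (h4 p hp) (h3 q hq)
  refine hasSplit_singleton_union (k := c x q) (hP.mono Set.subset_union_left) hx ?_
  rintro y (hy | hy)
  · exact key y hy q hq
  · exact (key p hp y hy).symm.trans (key p hp q hq)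

theorem hasSplit_of_no_small_prime (hc : IsReversible c) {s : Set V} (hfin : s.Finite)
    (hprime : ∀ Y ⊆ s, 3 ≤ Y.ncard → Y.ncard ≤ 4 → ¬ IsPrimeOn c Y) (h2 : 2 ≤ s.ncard) :
    HasSplit c s := by
  induction s, hfin using Set.Finite.induction_on with
  | empty => simp at h2
  | @insert a s ha hs ih =>
    rw [Set.ncard_insert_of_notMem ha hs] at h2
    rcases h2.eq_or_lt with h | h
    · obtain ⟨b, rfl⟩ := Set.ncard_eq_one.1 (by omega : s.ncard = 1)
      exact hasSplit_singleton_union (k := c a b) (by simp) ha (by simp)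
    · exact hasSplit_insert hc ha hprime
        (ih (fun Y hY => hprime Y (hY.trans (Set.subset_insert a s))) (by omega))

theorem IsModuleOn.of_forall_color_eq (hc : IsReversible c) {s P : Set V} (hPs : P ⊆ s)
    (h : ∀ a ∈ P, ∀ b ∈ P, ∀ x ∈ s, x ∉ P → c a x = c b x) : IsModuleOn c s P :=
  ⟨hPs, fun a ha b hb x hx hxP => hc _ _ _ _ (h a ha b hb x hx hxP)⟩

/-- A prime coloring of at least three elements has a prime restriction to three or four
elements. -/
theorem IsPrimeOn.exists_small [Finite V] (hc : IsReversible c) (hV : IsPrimeOn c Set.univ)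
    (h3 : 3 ≤ Nat.card V) : ∃ Y : Set V, IsPrimeOn c Y ∧ 3 ≤ Y.ncard ∧ Y.ncard ≤ 4 := by
  by_contra! H
  -- Both sides of a split are proper modules; with at least three elements in all, one side is not
  -- a singleton.
  obtain ⟨P, Q, k, ⟨p, hp⟩, ⟨q, hq⟩, hd, hu, hk⟩ :=
    hasSplit_of_no_small_prime hc (s := Set.univ) Set.finite_univ
      (fun Y _ h3 h4 hY => by have := H Y hY h3; omega) (by rw [Set.ncard_univ]; omega)
  have hd' := Set.disjoint_left.1 hd
  have hP : IsModuleOn c Set.univ P := IsModuleOn.of_forall_color_eq hc (Set.subset_univ _)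
    fun a ha b hb x hx hxP => by
      have hxQ : x ∈ Q := (hu ▸ hx : x ∈ P ∪ Q).resolve_left hxP
      rw [hk a ha x hxQ, hk b hb x hxQ]
  have hQ : IsModuleOn c Set.univ Q := ⟨Set.subset_univ _, fun a ha b hb x hx hxQ => by
    have hxP : x ∈ P := (hu ▸ hx : x ∈ P ∪ Q).resolve_right hxQ
    rw [hk x hxP a ha, hk x hxP b hb]⟩
  have hcard : P.ncard + Q.ncard = Nat.card V := by
    rw [← Set.ncard_union_eq hd, hu, Set.ncard_univ]
  rcases hV P hP with h | h
  · rcases hV Q hQ with h' | h'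
    · have h1 := (Set.ncard_le_one P.toFinite).2 fun a ha b hb => h ha hb
      have h2 := (Set.ncard_le_one Q.toFinite).2 fun a ha b hb => h' ha hb
      omega
    · exact hd' hp (h' ▸ Set.mem_univ p)
  · exact hd' (h ▸ Set.mem_univ q) hq

/-- A prime coloring has prime restrictions of size `n` or `n + 1` for every `n` that is at least
three and at most the number of elements. -/
theorem IsPrimeOn.exists_ncard [Finite V] (hc : IsReversible c) (hV : IsPrimeOn c Set.univ)
    {n : ℕ} (h3 : 3 ≤ n) (hn : n ≤ Nat.card V) :
    ∃ Y : Set V, IsPrimeOn c Y ∧ n ≤ Y.ncard ∧ Y.ncard ≤ n + 1 := by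
  induction n, h3 using Nat.le_induction with
  | base => exact hV.exists_small hc hn
  | succ n h3 ih =>
    obtain ⟨Y, hY, h1, h2⟩ := ih (by omega)
    -- Size `n` grows to `n + 1` or `n + 2`; size `n + 1` already suffices.
    rcases h1.eq_or_lt with h | h
    · have hne : Y ≠ Set.univ := by
        rintro rfl
        rw [Set.ncard_univ] at h
        omega
      obtain ⟨x, hx, y, hy, hp⟩ := exists_isPrimeOn_insert hc hY (by omega) hV hne
      refine ⟨_, hp, ?_, ?_⟩
      · have := Set.ncard_lt_ncard (s := Y) (t := insert x (insert y Y))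
          ((Set.ssubset_insert hy).trans_subset (Set.subset_insert _ _)) (Set.toFinite _)
        omega
      · have := Set.ncard_insert_le x (insert y Y)
        have := Set.ncard_insert_le y Y
        omega
    · exact ⟨Y, hY, by omega, by omega⟩

end Coloring

open FirstOrder CategoryTheory

/-! ### Transfer from colorings to structures. -/

section Structures

variable (L : FirstOrder.Language.{u, v})

/-- The binary relations that hold from `a` to `b` and from `b` to `a`. -/
def pairColor (M : Type w) [L.Structure M] (a b : M) : L.Relations 2 → Prop × Prop :=
  fun ρ => (Language.Structure.RelMap ρ ![a, b], Language.Structure.RelMap ρ ![b, a])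

theorem isReversible_pairColor (M : Type w) [L.Structure M] : IsReversible (pairColor L M) :=
  fun _ _ _ _ h => funext fun ρ => Prod.ext (congrArg Prod.snd (congrFun h ρ))
    (congrArg Prod.fst (congrFun h ρ))

theorem pairColor_eq_iff (M : Type w) [L.Structure M] {a b x y : M} :
    pairColor L M a b = pairColor L M x y ↔ ∀ ρ : L.Relations 2,
      (Language.Structure.RelMap ρ ![a, b] ↔ Language.Structure.RelMap ρ ![x, y]) ∧
      (Language.Structure.RelMap ρ ![b, a] ↔ Language.Structure.RelMap ρ ![y, x]) := by
  simp [funext_iff, pairColor]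

theorem isModule_iff (M : Type w) [L.Structure M] (A : Set M) :
    IsModule L M A ↔ IsModuleOn (pairColor L M) Set.univ A := by
  simp only [IsModule, IsModuleOn, pairColor_eq_iff, Set.subset_univ, true_and, Set.mem_univ,
    forall_const]
  exact ⟨fun h a ha b hb x hx ρ => h ρ a ha b hb x hx, fun h ρ a ha b hb x hx => h a ha b hb x hx ρ⟩

theorem isPrimeStructure_iff (M : Type w) [L.Structure M] :
    IsPrimeStructure L M ↔ IsPrimeOn (pairColor L M) Set.univ := by
  simp only [IsPrimeStructure, IsPrimeOn, isModule_iff, ← or_assoc]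
  refine forall_congr' fun A => imp_congr_right fun _ => or_congr_left ?_
  exact ⟨by rintro (rfl | ⟨a, rfl⟩) <;> simp, fun h => h.eq_empty_or_singleton⟩

theorem isPrimeStructure_of_embedding {M N : Type w} [L.Structure M] [L.Structure N]
    (f : N ↪[L] M) (h : IsPrimeOn (pairColor L M) (Set.range f)) : IsPrimeStructure L N := by
  rw [isPrimeStructure_iff]
  have hf : ∀ a b, pairColor L M (f a) (f b) = pairColor L N a b := by
    intro a b
    funext ρ
    have h1 : ∀ a b : N, ![f a, f b] = f ∘ ![a, b] := fun a b => by
      ext i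
      fin_cases i <;> rfl
    simp only [pairColor, h1, f.map_rel]
  intro A hA
  have hm : IsModuleOn (pairColor L M) (Set.range f) (f '' A) := by
    refine ⟨Set.image_subset_range f A, ?_⟩
    rintro _ ⟨a, ha, rfl⟩ _ ⟨b, hb, rfl⟩ _ ⟨x, rfl⟩ hx
    rw [hf, hf]
    exact hA.2 a ha b hb x (Set.mem_univ x) fun h => hx ⟨x, h, rfl⟩
  rcases h _ hm with h | h
  · exact Or.inl fun a ha b hb => f.injective (h ⟨a, ha, rfl⟩ ⟨b, hb, rfl⟩)
  · right
    rwa [← Set.image_univ, f.injective.image_injective.eq_iff] at h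

variable {L}

theorem IsPrimeStructure.exists_substructure [L.IsRelational] {M : Type w} [L.Structure M]
    [Finite M] (hM : IsPrimeStructure L M) {n : ℕ} (h3 : 3 ≤ n) (hn : n ≤ Nat.card M) :
    ∃ S : L.Substructure M, IsPrimeStructure L S ∧ n ≤ Nat.card S ∧ Nat.card S ≤ n + 1 := by
  obtain ⟨Y, hY, h1, h2⟩ := ((isPrimeStructure_iff L M).1 hM).exists_ncard
    (isReversible_pairColor L M) h3 hn
  have hS : ((Language.Substructure.closure L Y : L.Substructure M) : Set M) = Y :=
    Language.Substructure.closure_eq_of_isRelational L Y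
  refine ⟨Language.Substructure.closure L Y, ?_, ?_, ?_⟩
  · refine isPrimeStructure_of_embedding L (Language.Substructure.subtype _) ?_
    have : Set.range (Language.Substructure.closure L Y).subtype = Y := by
      rw [Language.Substructure.coe_subtype, Subtype.range_coe_subtype]
      exact hS
    rwa [this]
  · exact h1.trans_eq (congrArg Set.ncard hS).symm
  · exact (congrArg Set.ncard hS).trans_le h2

theorem IsHereditaryClass.mem_of_embedding {C : Set (Bundled.{w} L.Structure)}
    (hC : IsHereditaryClass C) {M N : Bundled.{w} L.Structure} (hM : M ∈ C) (f : N ↪[L] M) :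
    N ∈ C := by
  have := hC.1 M hM
  have : Finite N := Finite.of_injective f f.injective
  exact hC.2 M hM ⟨Language.Structure.FG.of_finite, ⟨f⟩⟩

theorem IsHereditaryClass.sInter {S : Set (Set (Bundled.{w} L.Structure))} (hne : S.Nonempty)
    (hS : ∀ D ∈ S, IsHereditaryClass D) : IsHereditaryClass (⋂₀ S) := by
  obtain ⟨D, hD⟩ := hne
  exact ⟨fun M hM => (hS D hD).1 M (hM D hD),
    fun M hM N hN E hE => (hS E hE).2 M (hM E hE) hN⟩

/-! ### Finiteness up to isomorphism, and chains of hereditary classes. -/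

theorem finite_structure (hL : IsFiniteBinarySignature L) (M : Type w) [Finite M] :
    Finite (L.Structure M) := by
  have := hL.finite
  have := hL.isRelational
  refine Finite.of_injective
    (fun S : L.Structure M => fun r : Σ n, L.Relations n => {x | S.RelMap r.2 x}) ?_
  intro S T h
  ext n r x
  · exact isEmptyElim r
  · have := congrFun h ⟨n, r⟩
    exact (Set.ext_iff.1 this x)

/-- Up to isomorphism, there are finitely many finite structures of bounded size. -/
theorem finite_classes_card_le (hL : IsFiniteBinarySignature L) (n : ℕ) :
    ((Quotient.mk (Language.equivSetoid (L := L))) ''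
      {M : Bundled.{w} L.Structure | Finite M ∧ Nat.card M ≤ n}).Finite := by
  have := fun m : ℕ => finite_structure hL (ULift.{w} (Fin m))
  let F : (Σ m : Fin (n + 1), L.Structure (ULift.{w} (Fin m))) →
      Quotient (Language.equivSetoid (L := L)) := fun p => Quotient.mk _ ⟨ULift (Fin p.1), p.2⟩
  refine (Set.finite_range F).subset ?_
  rintro _ ⟨M, ⟨hM, hn⟩, rfl⟩
  let e : M ≃ ULift.{w} (Fin (Nat.card M)) := (Finite.equivFin M).trans Equiv.ulift.symm
  refine ⟨⟨⟨Nat.card M, by omega⟩, e.inducedStructure⟩, ?_⟩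
  exact (Quotient.sound (s := Language.equivSetoid) ⟨e.bundledInducedEquiv L⟩).symm

theorem exists_prime_card_gt (hL : IsFiniteBinarySignature L) {C : Set (Bundled.{w} L.Structure)}
    (hC : IsHereditaryClass C) (hinf : (primes C).Infinite) (n : ℕ) :
    ∃ M ∈ C, IsPrimeStructure L M ∧ n < Nat.card M := by
  by_contra! H
  refine hinf ((finite_classes_card_le hL n).subset ?_)
  rintro _ ⟨M, ⟨hM, hp⟩, rfl⟩
  exact ⟨M, ⟨hC.1 M hM, H M hM hp⟩, rfl⟩

theorem exists_prime_card_mem (hL : IsFiniteBinarySignature L) {C : Set (Bundled.{w} L.Structure)}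
    (hC : IsHereditaryClass C) (hinf : (primes C).Infinite) {n : ℕ} (h3 : 3 ≤ n) :
    ∃ M ∈ C, IsPrimeStructure L M ∧ n ≤ Nat.card M ∧ Nat.card M ≤ n + 1 := by
  have := hL.isRelational
  obtain ⟨M, hM, hp, hn⟩ := exists_prime_card_gt hL hC hinf n
  have := hC.1 M hM
  obtain ⟨S, hS, h1, h2⟩ := hp.exists_substructure h3 hn.le
  exact ⟨Bundled.of S, hC.mem_of_embedding hM S.subtype, hS, h1, h2⟩

/-- The traces on `T` form a chain of finitely many nonempty sets, so the least one lies in all the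
others. -/
theorem exists_forall_mem_of_isChain {α ι : Type*} {c : Set ι} (P : ι → Set α)
    (hne : c.Nonempty) (hc : ∀ i ∈ c, ∀ j ∈ c, P i ⊆ P j ∨ P j ⊆ P i) {T : Set α} (hT : T.Finite)
    (h : ∀ i ∈ c, (P i ∩ T).Nonempty) : ∃ t ∈ T, ∀ i ∈ c, t ∈ P i := by
  obtain ⟨i, hi, hmin⟩ : ∃ i ∈ c, ∀ j ∈ c, P i ∩ T ⊆ P j := by
    have hfin : ((fun i => P i ∩ T) '' c).Finite :=
      hT.finite_subsets.subset (by rintro _ ⟨i, -, rfl⟩; exact Set.inter_subset_right)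
    obtain ⟨_, ⟨i, hi, rfl⟩, hm⟩ := hfin.exists_minimal (hne.image _)
    refine ⟨i, hi, fun j hj => ?_⟩
    rcases hc i hi j hj with h | h
    · exact Set.inter_subset_left.trans h
    · exact (hm ⟨j, hj, rfl⟩ (Set.inter_subset_inter_left T h)).trans Set.inter_subset_left
  obtain ⟨t, ht, htT⟩ := h i hi
  exact ⟨t, htT, fun j hj => hmin j hj ⟨ht, htT⟩⟩

theorem infinite_primes_sInter (hL : IsFiniteBinarySignature L)
    {S : Set (Set (Bundled.{w} L.Structure))} (hne : S.Nonempty) (hchain : IsChain (· ⊆ ·) S)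
    (hS : ∀ D ∈ S, IsHereditaryClass D ∧ (primes D).Infinite) : (primes (⋂₀ S)).Infinite := by
  have key : ∀ n, 3 ≤ n → ∃ M ∈ ⋂₀ S, IsPrimeStructure L M ∧ n ≤ Nat.card M := by
    intro n h3
    -- The upper bound `n + 1` makes `T` finite; the lower bound `n` forces unbounded sizes as `n`
    -- varies.
    let T := Quotient.mk (Language.equivSetoid (L := L)) ''
      {M : Bundled.{w} L.Structure |
        (Finite M ∧ Nat.card M ≤ n + 1) ∧ IsPrimeStructure L M ∧ n ≤ Nat.card M}
    have hT : T.Finite :=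
      (finite_classes_card_le hL (n + 1)).subset (Set.image_mono fun M hM => hM.1)
    obtain ⟨_, ⟨M, ⟨-, hp, hn⟩, rfl⟩, hM⟩ := exists_forall_mem_of_isChain
      (fun D : Set (Bundled.{w} L.Structure) =>
        Quotient.mk (Language.equivSetoid (L := L)) '' D) hne
      (fun D hD E hE => (hchain.total hD hE).imp Set.image_mono Set.image_mono) hT (by
        intro D hD
        obtain ⟨M, hM, hp, h1, h2⟩ := exists_prime_card_mem hL (hS D hD).1 (hS D hD).2 h3
        exact ⟨_, ⟨M, hM, rfl⟩, ⟨M, ⟨⟨(hS D hD).1.1 M hM, h2⟩, hp, h1⟩, rfl⟩⟩)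
    refine ⟨M, fun D hD => ?_, hp, hn⟩
    obtain ⟨N, hN, h⟩ := hM D hD
    obtain ⟨e⟩ : Nonempty (N ≃[L] M) := Quotient.exact h
    exact (hS D hD).1.mem_of_embedding hN e.symm.toEmbedding
  intro hfin
  -- Size is an isomorphism invariant, so finitely many classes would bound it.
  let card : Quotient (Language.equivSetoid (L := L)) → ℕ :=
    Quotient.lift (fun M : Bundled.{w} L.Structure => Nat.card M)
      fun M N ⟨e⟩ => Nat.card_congr e.toEquiv
  obtain ⟨b, hb⟩ := (hfin.image card).bddAbove
  obtain ⟨M, hM, hp, hn⟩ := key (b + 3) (by omega)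
  have : Nat.card M ≤ b := hb ⟨_, ⟨M, ⟨hM, hp⟩, rfl⟩, rfl⟩
  omega

end Structures

end BinaryStructures

theorem mainTheorem6 (L : FirstOrder.Language.{u, v})
    (hL : BinaryStructures.IsFiniteBinarySignature L)
    (C : Set (CategoryTheory.Bundled.{w} L.Structure))
    (hC : BinaryStructures.IsHereditaryClass C)
    (hinf : (BinaryStructures.primes C).Infinite) :
    ∃ D : Set (CategoryTheory.Bundled.{w} L.Structure),
      D ⊆ C ∧ BinaryStructures.IsMinimalPrime D := by
  obtain ⟨D, hDC, hD⟩ := zorn_superset_nonempty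
    {D | BinaryStructures.IsHereditaryClass D ∧ (BinaryStructures.primes D).Infinite}
    (fun S hS hchain hne => ⟨⋂₀ S,
      ⟨BinaryStructures.IsHereditaryClass.sInter hne fun D hD => (hS hD).1,
        BinaryStructures.infinite_primes_sInter hL hne hchain hS⟩,
      fun D hD => Set.sInter_subset_of_mem hD⟩) C ⟨hC, hinf⟩
  refine ⟨D, hDC, hD.prop.1, hD.prop.2, fun E hE hED => ?_⟩
  by_contra hEinf
  exact hED.2 (hD.le_of_le ⟨hE, hEinf⟩ hED.1)
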